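/- All graphs are finite and simple. A rooted labeled graph $G$ consists of a graph, a bijection $\lambda\colon V(G)\to X$ onto a label set $X$, and a root vertex; $v_x=\lambda^{-1}(x)$ is the vertex labeled $x\in X$. For $\sigma\in\operatorname{Sym}(X)$ let $G_\sigma$ be the graph with vertex set $V(G)$ in which $v_xv_y$ is an edge iff $v_{\sigma(x)}v_{\sigma(y)}\in E(G)$, and let $\operatorname{Aut}(G)=\{\sigma\in\operatorname{Sym}(X) : G_\sigma=G\}$. A (non-neutral) feasible edge-replacement $e\to e'$ consists of an edge $e$ of $G$ and an edge $e'$ of the complement $\overline{G}$ such that $G-e+e'\cong G$. Let $\mathcal{E}_G$ be the set of all $\sigma\in\operatorname{Sym}(X)$ with $\sigma\in\operatorname{Aut}(G)$ (neutral edge-replacement) or $G_\sigma=G-e+e'$ for some feasible $e\to e'$. For $i\in X$ let $\mathcal{E}_G^i=\{\sigma\in\mathcal{E}_G : \sigma(i)=i\}$. The hang group of $G$ at $i$ is $\mathbf{H}_i(G)=\langle \mathcal{E}_G^i\cup\operatorname{Aut}(G)\rangle$, and $G$ is hang-symmetric with root labeled $i$ if its root has label $i$ and $\mathbf{H}_i(G)=\operatorname{Sym}(X)$.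 Let $G^*$ be $G$ together with one new isolated vertex carrying a new label, with the root of $G$ as its root. For rooted labeled graphs $G$, $H$ with label sets $X$, $B$ and roots $u_0$, $w_0$, the comb product $G*H$ has vertex set $V(G)\times V(H)$; its edges are $(u,w_0)(u',w_0)$ for $uu'\in E(G)$, and $(u,w)(u,w')$ for $u\in V(G)$, $ww'\in E(H)$. The vertex $(u,w)$ has label $(b,x)\in B\times X$, where $b$ is the label of $w$ and $x$ is the label of $u$; the root is $(u_0,w_0)$. Corollary. Let $G$ and $H$ be rooted labeled graphs. If $G^*$ is hang-symmetric with root labeled $i$ and $H^*$ is hang-symmetric with root labeled $j$, then $(G*H)^*$ is hang-symmetric with root labeled $(j,i)$. -/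

import Mathlib

/-- A rooted labeled simple graph: a graph on the vertex set `V`, a bijective labeling of the
vertices by the label set `X`, and a distinguished vertex. -/
structure RootedLabeledGraph (V X : Type*) where
  graph : SimpleGraph V
  label : V ≃ X
  root : V

namespace RootedLabeledGraph

variable {V W X B : Type*}

/-- The graph `G_σ`: with `v_x` the vertex labeled `x`, the vertices `v_x`, `v_y` are adjacent in
`G_σ` iff `σ(x)σ(y)` is the pair of labels of an edge of `G`. -/
def embedding (G : RootedLabeledGraph V X) (σ : Equiv.Perm X) : SimpleGraph V :=
  G.graph.comap fun u => G.label.symm (σ (G.label u))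

/-- The pair of vertices whose pair of labels is `e`. -/
def pairOf (G : RootedLabeledGraph V X) (e : Sym2 X) : Sym2 V :=
  e.map G.label.symm

/-- The graph `G - e + e'`, where `e`, `e'` are given by their labels. -/
def replaceEdge (G : RootedLabeledGraph V X) (e e' : Sym2 X) : SimpleGraph V :=
  G.graph.deleteEdges {G.pairOf e} ⊔ SimpleGraph.fromEdgeSet {G.pairOf e'}

/-- `e → e'` is a feasible, non-neutral edge-replacement: `e` labels an edge of `G`, `e'` labels an
edge of the complement of `G` (in particular `e ≠ e'`), and `G - e + e'` is isomorphic to `G`. -/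
def IsFeasible (G : RootedLabeledGraph V X) (e e' : Sym2 X) : Prop :=
  G.pairOf e ∈ G.graph.edgeSet ∧ G.pairOf e' ∈ (G.graphᶜ).edgeSet ∧
    Nonempty (G.replaceEdge e e' ≃g G.graph)

/-- The automorphisms of `G`, as permutations of the labels. These are also the permutations
associated with the neutral edge-replacement. -/
def autSet (G : RootedLabeledGraph V X) : Set (Equiv.Perm X) :=
  {σ | G.embedding σ = G.graph}

/-- The permutations associated with the edge-replacement `e → e'`. -/
def ferSet (G : RootedLabeledGraph V X) (e e' : Sym2 X) : Set (Equiv.Perm X) :=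
  {σ | G.embedding σ = G.replaceEdge e e'}

/-- The set of all permutations associated with feasible edge-replacements of `G`, the neutral one
included. -/
def ferGenerators (G : RootedLabeledGraph V X) : Set (Equiv.Perm X) :=
  G.autSet ∪ {σ | ∃ e e' : Sym2 X, G.IsFeasible e e' ∧ σ ∈ G.ferSet e e'}

/-- The permutations associated with feasible edge-replacements that fix the label `i`. -/
def ferGeneratorsFixing (G : RootedLabeledGraph V X) (i : X) : Set (Equiv.Perm X) :=
  {σ | σ ∈ G.ferGenerators ∧ σ i = i}

/-- The hang group of `G` at the label `i`. -/
def hangGroup (G : RootedLabeledGraph V X) (i : X) : Subgroup (Equiv.Perm X) :=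
  Subgroup.closure (G.ferGeneratorsFixing i ∪ G.autSet)

/-- `G` is hang-symmetric with root labeled `i`. -/
def IsHangSymmetricWithRoot (G : RootedLabeledGraph V X) (i : X) : Prop :=
  G.label G.root = i ∧ G.hangGroup i = ⊤

/-- The graph `G^*`: `G` together with one new isolated vertex `none`, whose label is the new label
`none`; the root is inherited from `G`. -/
def addIsolated (G : RootedLabeledGraph V X) : RootedLabeledGraph (Option V) (Option X) where
  graph := G.graph.map Function.Embedding.some
  label := Equiv.optionCongr G.label
  root := some G.root

/-- The comb product `G * H`: a copy of `H` is glued by its root to each vertex of `G`. The vertex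
`(u, w)` has the label `(b, x)`, where `x` labels `u` in `G` and `b` labels `w` in `H`. -/
def comb (G : RootedLabeledGraph V X) (H : RootedLabeledGraph W B) :
    RootedLabeledGraph (V × W) (B × X) where
  graph :=
    { Adj := fun p q =>
        (G.graph.Adj p.1 q.1 ∧ p.2 = H.root ∧ q.2 = H.root) ∨
          (p.1 = q.1 ∧ H.graph.Adj p.2 q.2)
      symm := ⟨fun _ _ h => h.elim
        (fun h => Or.inl ⟨h.1.symm, h.2.2, h.2.1⟩) (fun h => Or.inr ⟨h.1.symm, h.2.symm⟩)⟩
      loopless := ⟨fun _ h => h.elim (fun h => h.1.ne rfl) (fun h => h.2.ne rfl)⟩ }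
  label := (Equiv.prodComm V W).trans (H.label.prodCongr G.label)
  root := (G.root, H.root)

end RootedLabeledGraph

/-! On a finite graph all graphs `G_σ` have equally many edges, so `σ` belongs to a feasible
replacement or is an automorphism iff it loses at most one edge (`mem_ferGenerators_iff`). This
turns the claim into one about graphs on labels. The copies of `H*` at the vertices `u` of `G` share
only the isolated vertex `none`, so their symmetric groups together generate everything
(`eq_top_of_forall_copyHom_mem`). Call `u` bad if the hang group `M` misses some permutation of its
copy. Generators for `H*` that fix the root act on any copy; automorphisms that move the root also
break the edges of `G` at `u`, which is harmless only if there are few of them. A generator `σ` for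
`G*` sending `k` to `none` loses every edge at `k`, so `k` has degree at most one and is not bad.
Otherwise `σ` carries `k` to a vertex whose copy is conjugate in `M`. Bad vertices thus form a set
invariant under `Sym` of the labels of `G*`; it omits `none`, so it is empty. -/

open Equiv

namespace SimpleGraph

variable {X B : Type*}

/-- Permutations of the vertices that map every edge to an edge. -/
def edgePreserving (Γ : SimpleGraph X) : Set (Perm X) :=
  {σ | ∀ x y, Γ.Adj x y → Γ.Adj (σ x) (σ y)}

/-- Permutations of the vertices that map every edge, with at most one exception, to an edge. -/
def almostEdgePreserving (Γ : SimpleGraph X) : Set (Perm X) :=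
  {σ | ∃ e : Sym2 X, ∀ x y, Γ.Adj x y → s(x, y) ≠ e → Γ.Adj (σ x) (σ y)}

/-- The hang group, described by (almost) edge-preserving permutations. -/
def almostHangGroup (Γ : SimpleGraph X) (i : X) : Subgroup (Perm X) :=
  Subgroup.closure ({σ | σ ∈ Γ.almostEdgePreserving ∧ σ i = i} ∪ Γ.edgePreserving)

/-- The comb product of `Γ` with `Δ` rooted at `j`, on pairs of labels. -/
def combAt (Γ : SimpleGraph X) (Δ : SimpleGraph B) (j : B) : SimpleGraph (B × X) where
  Adj p q := (Γ.Adj p.2 q.2 ∧ p.1 = j ∧ q.1 = j) ∨ (p.2 = q.2 ∧ Δ.Adj p.1 q.1)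
  symm := ⟨fun _ _ h => h.elim
    (fun h => Or.inl ⟨h.1.symm, h.2.2, h.2.1⟩) (fun h => Or.inr ⟨h.1.symm, h.2.symm⟩)⟩
  loopless := ⟨fun _ h => h.elim (fun h => h.1.ne rfl) (fun h => h.2.ne rfl)⟩

/-- `Γ` with an additional isolated vertex `none`. -/
abbrev withIsolated (Γ : SimpleGraph X) : SimpleGraph (Option X) :=
  Γ.map Function.Embedding.some

lemma withIsolated_adj {Γ : SimpleGraph X} {a b : Option X} :
    Γ.withIsolated.Adj a b ↔ ∃ x y, Γ.Adj x y ∧ some x = a ∧ some y = b :=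
  SimpleGraph.map_adj Function.Embedding.some Γ a b

lemma withIsolated_adj_some {Γ : SimpleGraph X} {x y : X} :
    Γ.withIsolated.Adj (some x) (some y) ↔ Γ.Adj x y :=
  SimpleGraph.map_adj_apply (f := Function.Embedding.some)

lemma withIsolated_not_adj_none {Γ : SimpleGraph X} {a : Option X} :
    ¬ Γ.withIsolated.Adj none a := by
  simp

/-! ### Permutations of a graph with an isolated vertex -/

section RemoveNone

variable {Γ : SimpleGraph X} {σ : Perm (Option X)}

/-- An edge never meets `none`, so `removeNone σ` agrees with `σ` at both ends. -/
lemma removeNone_adj {x y : X} (h : Γ.withIsolated.Adj (σ (some x)) (σ (some y))) :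
    Γ.Adj (removeNone σ x) (removeNone σ y) := by
  obtain ⟨a, b, hab, ha, hb⟩ := withIsolated_adj.1 h
  have hx := removeNone_some σ ⟨a, ha.symm⟩
  have hy := removeNone_some σ ⟨b, hb.symm⟩
  rw [← withIsolated_adj_some, hx, hy]
  exact h

lemma removeNone_mem_edgePreserving (h : σ ∈ Γ.withIsolated.edgePreserving) :
    removeNone σ ∈ Γ.edgePreserving := fun _ _ hxy =>
  removeNone_adj (h _ _ (withIsolated_adj_some.2 hxy))

lemma removeNone_mem_almostEdgePreserving [Nonempty X]
    (h : σ ∈ Γ.withIsolated.almostEdgePreserving) :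
    removeNone σ ∈ Γ.almostEdgePreserving := by
  obtain ⟨e, he⟩ := h
  by_cases hex : ∃ e' : Sym2 X, e'.map some = e
  · obtain ⟨e', rfl⟩ := hex
    refine ⟨e', fun x y hxy hne => removeNone_adj (he _ _ (withIsolated_adj_some.2 hxy) ?_)⟩
    exact fun h => hne (Sym2.map.injective (Option.some_injective X) h)
  -- The exceptional pair involves `none`, so no edge of `Γ` is lost; a diagonal pair serves as
  -- dummy exception.
  · have z : X := Classical.arbitrary X
    refine ⟨s(z, z), fun x y hxy _ => removeNone_adj (he _ _ (withIsolated_adj_some.2 hxy) ?_)⟩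
    exact fun h => hex ⟨s(x, y), h⟩

lemma not_adj_of_map_eq_none {k : X} (h : σ ∈ Γ.withIsolated.edgePreserving)
    (hk : σ (some k) = none) (y : X) : ¬ Γ.Adj k y := fun hy => by
  have := h _ _ (withIsolated_adj_some.2 hy)
  rw [hk] at this
  exact withIsolated_not_adj_none this

lemma exists_forall_adj_eq_of_map_eq_none {k : X} (h : σ ∈ Γ.withIsolated.almostEdgePreserving)
    (hk : σ (some k) = none) : ∃ m, ∀ y, Γ.Adj k y → y = m := by
  obtain ⟨e, he⟩ := h
  have key : ∀ y, Γ.Adj k y → s(some k, some y) = e := fun y hy => by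
    by_contra hne
    have := he _ _ (withIsolated_adj_some.2 hy) hne
    rw [hk] at this
    exact withIsolated_not_adj_none this
  by_cases hm : ∃ m, Γ.Adj k m
  · obtain ⟨m, hm⟩ := hm
    refine ⟨m, fun y hy => ?_⟩
    have := (key y hy).trans (key m hm).symm
    simpa using Sym2.congr_right.1 this
  · exact ⟨k, fun y hy => absurd ⟨y, hy⟩ hm⟩

end RemoveNone

/-! ### Actions of one copy and of the base on the comb product -/

/-- The copy of `Δ*` inside the comb product with an isolated vertex, at the vertex `u`. -/
def copyEmbedding (B : Type*) (u : X) : Option B ↪ Option (B × X) :=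
  Function.Embedding.optionMap ⟨fun b => (b, u), fun _ _ h => (Prod.mk.inj h).1⟩

@[simp] lemma copyEmbedding_some (u : X) (b : B) : copyEmbedding B u (some b) = some (b, u) := rfl

@[simp] lemma copyEmbedding_none (u : X) : copyEmbedding B u none = none := rfl

/-- Permutations of the copy of `Δ*` at `u`, extended by the identity. -/
noncomputable def copyHom (B : Type*) (u : X) : Perm (Option B) →* Perm (Option (B × X)) :=
  Perm.viaEmbeddingHom (copyEmbedding B u)

lemma copyHom_apply (u : X) (α : Perm (Option B)) (a : Option B) :
    copyHom B u α (copyEmbedding B u a) = copyEmbedding B u (α a) :=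
  Perm.viaEmbedding_apply α (copyEmbedding B u) a

lemma copyHom_apply_some_self (u : X) (α : Perm (Option B)) (b : B) :
    copyHom B u α (some (b, u)) = copyEmbedding B u (α (some b)) :=
  copyHom_apply u α (some b)

lemma copyHom_apply_some_of_ne {u x : X} (hx : x ≠ u) (α : Perm (Option B)) (b : B) :
    copyHom B u α (some (b, x)) = some (b, x) := by
  refine Perm.viaEmbedding_apply_of_notMem α (copyEmbedding B u) _ ?_
  rintro ⟨_ | c, hc⟩
  · simp at hc
  · simp only [copyEmbedding_some, Option.some.injEq, Prod.mk.injEq] at hc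
    exact hx hc.2.symm

/-- A permutation of the vertices of `Γ`, acting on the comb product with an isolated vertex. -/
def baseHom (B : Type*) : Perm X →* Perm (Option (B × X)) where
  toFun q := optionCongr ((Equiv.refl B).prodCongr q)
  map_one' := by ext a : 1; rcases a with _ | ⟨b, x⟩ <;> rfl
  map_mul' p q := by ext a : 1; rcases a with _ | ⟨b, x⟩ <;> rfl

@[simp] lemma baseHom_apply_some (q : Perm X) (b : B) (x : X) :
    baseHom B q (some (b, x)) = some (b, q x) := rfl

lemma baseHom_apply_copyEmbedding (q : Perm X) (u : X) (a : Option B) :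
    baseHom B q (copyEmbedding B u a) = copyEmbedding B (q u) a := by
  cases a <;> rfl

lemma baseHom_conj_copyHom (q : Perm X) (u : X) (α : Perm (Option B)) :
    baseHom B q * copyHom B u α * (baseHom B q)⁻¹ = copyHom B (q u) α := by
  rw [mul_inv_eq_iff_eq_mul]
  ext a : 1
  have hcopy : ∀ c : Option B, (baseHom B q * copyHom B u α) (copyEmbedding B u c) =
      (copyHom B (q u) α * baseHom B q) (copyEmbedding B u c) := fun c => by
    rw [Perm.mul_apply, Perm.mul_apply, copyHom_apply, baseHom_apply_copyEmbedding,
      baseHom_apply_copyEmbedding, copyHom_apply]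
  rcases a with _ | ⟨b, x⟩
  · exact hcopy none
  · by_cases hx : x = u
    · subst hx
      exact hcopy (some b)
    · rw [Perm.mul_apply, Perm.mul_apply, copyHom_apply_some_of_ne hx, baseHom_apply_some,
        copyHom_apply_some_of_ne (q.injective.ne hx)]

/-! ### The hang group of the comb product -/

section Comb

variable {Γ : SimpleGraph X} {Δ : SimpleGraph B} {i : X} {j : B}

lemma combAt_adj {p q : B × X} : (Γ.combAt Δ j).Adj p q ↔
    (Γ.Adj p.2 q.2 ∧ p.1 = j ∧ q.1 = j) ∨ (p.2 = q.2 ∧ Δ.Adj p.1 q.1) := Iff.rfl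

lemma adj_copyEmbedding (u : X) {a c : Option B} (h : Δ.withIsolated.Adj a c) :
    (Γ.combAt Δ j).withIsolated.Adj (copyEmbedding B u a) (copyEmbedding B u c) := by
  obtain ⟨b, d, hbd, rfl, rfl⟩ := withIsolated_adj.1 h
  exact withIsolated_adj_some.2 (Or.inr ⟨rfl, hbd⟩)

lemma adj_root {x y : X} (h : Γ.Adj x y) :
    (Γ.combAt Δ j).withIsolated.Adj (some (j, x)) (some (j, y)) :=
  withIsolated_adj_some.2 (Or.inl ⟨h, rfl, rfl⟩)

lemma adj_comb_cases {a c : Option (B × X)} (h : (Γ.combAt Δ j).withIsolated.Adj a c) :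
    (∃ x y, Γ.Adj x y ∧ some (j, x) = a ∧ some (j, y) = c) ∨
      ∃ u b d, Δ.Adj b d ∧ some (b, u) = a ∧ some (d, u) = c := by
  obtain ⟨⟨b, x⟩, ⟨d, y⟩, hbd, rfl, rfl⟩ := withIsolated_adj.1 h
  rcases hbd with ⟨h1, h2, h3⟩ | ⟨h1, h2⟩
  · simp only at h1 h2 h3
    subst h2 h3
    exact Or.inl ⟨x, y, h1, rfl, rfl⟩
  · simp only at h1 h2
    subst h1
    exact Or.inr ⟨x, b, d, h2, rfl, rfl⟩

/-- Edges inside the copies of `Δ` are respected by an edge-preserving permutation of one copy. -/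
lemma adj_copyHom_copy (u : X) {α : Perm (Option B)} {x : X} {b d : B} (hbd : Δ.Adj b d)
    (hα : x = u → Δ.withIsolated.Adj (α (some b)) (α (some d))) :
    (Γ.combAt Δ j).withIsolated.Adj (copyHom B u α (some (b, x))) (copyHom B u α (some (d, x))) := by
  by_cases hx : x = u
  · subst hx
    rw [copyHom_apply_some_self, copyHom_apply_some_self]
    exact adj_copyEmbedding _ (hα rfl)
  · rw [copyHom_apply_some_of_ne hx, copyHom_apply_some_of_ne hx]
    exact withIsolated_adj_some.2 (Or.inr ⟨rfl, hbd⟩)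

/-- With the root fixed, no edge between copies is touched. -/
lemma copyHom_mem_almostEdgePreserving_of_fix (u : X) {α : Perm (Option B)}
    (hα : α ∈ Δ.withIsolated.almostEdgePreserving) (hj : α (some j) = some j) :
    copyHom B u α ∈ (Γ.combAt Δ j).withIsolated.almostEdgePreserving := by
  obtain ⟨e, he⟩ := hα
  have hfix : ∀ x, copyHom B u α (some (j, x)) = some (j, x) := fun x => by
    by_cases hx : x = u
    · subst hx
      rw [copyHom_apply_some_self, hj, copyEmbedding_some]
    · exact copyHom_apply_some_of_ne hx α j
  refine ⟨e.map (copyEmbedding B u), fun a c hac hne => ?_⟩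
  obtain ⟨x, y, hxy, rfl, rfl⟩ | ⟨x, b, d, hbd, rfl, rfl⟩ := adj_comb_cases hac
  · rw [hfix, hfix]
    exact adj_root hxy
  · refine adj_copyHom_copy u hbd fun hx => he _ _ (withIsolated_adj_some.2 hbd) ?_
    rintro rfl
    subst hx
    exact hne rfl

lemma copyHom_mem_edgePreserving {k : X} {α : Perm (Option B)}
    (hα : α ∈ Δ.withIsolated.edgePreserving) (hk : ∀ y, ¬ Γ.Adj k y) :
    copyHom B k α ∈ (Γ.combAt Δ j).withIsolated.edgePreserving := fun a c hac => by
  obtain ⟨x, y, hxy, rfl, rfl⟩ | ⟨x, b, d, hbd, rfl, rfl⟩ := adj_comb_cases hac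
  · rw [copyHom_apply_some_of_ne, copyHom_apply_some_of_ne]
    · exact adj_root hxy
    · rintro rfl
      exact hk _ hxy.symm
    · rintro rfl
      exact hk _ hxy
  · exact adj_copyHom_copy k hbd fun _ => hα _ _ (withIsolated_adj_some.2 hbd)

/-- Only the edge joining the copy at `k` to the one at `m` can be lost. -/
lemma copyHom_mem_almostEdgePreserving {k m : X} {α : Perm (Option B)}
    (hα : α ∈ Δ.withIsolated.edgePreserving) (hk : ∀ y, Γ.Adj k y → y = m) :
    copyHom B k α ∈ (Γ.combAt Δ j).withIsolated.almostEdgePreserving := by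
  refine ⟨s(some (j, k), some (j, m)), fun a c hac hne => ?_⟩
  obtain ⟨x, y, hxy, rfl, rfl⟩ | ⟨x, b, d, hbd, rfl, rfl⟩ := adj_comb_cases hac
  · rw [copyHom_apply_some_of_ne, copyHom_apply_some_of_ne]
    · exact adj_root hxy
    · rintro rfl
      rw [hk _ hxy.symm] at hne
      exact hne Sym2.eq_swap
    · rintro rfl
      rw [hk _ hxy] at hne
      exact hne rfl
  · exact adj_copyHom_copy k hbd fun _ => hα _ _ (withIsolated_adj_some.2 hbd)

lemma baseHom_mem_edgePreserving {q : Perm X} (hq : q ∈ Γ.edgePreserving) :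
    baseHom B q ∈ (Γ.combAt Δ j).withIsolated.edgePreserving := fun a c hac => by
  obtain ⟨x, y, hxy, rfl, rfl⟩ | ⟨x, b, d, hbd, rfl, rfl⟩ := adj_comb_cases hac
  · exact adj_root (hq _ _ hxy)
  · exact withIsolated_adj_some.2 (Or.inr ⟨rfl, hbd⟩)

lemma baseHom_mem_almostEdgePreserving {q : Perm X} (hq : q ∈ Γ.almostEdgePreserving) :
    baseHom B q ∈ (Γ.combAt Δ j).withIsolated.almostEdgePreserving := by
  obtain ⟨e, he⟩ := hq
  refine ⟨e.map fun x => some (j, x), fun a c hac hne => ?_⟩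
  obtain ⟨x, y, hxy, rfl, rfl⟩ | ⟨x, b, d, hbd, rfl, rfl⟩ := adj_comb_cases hac
  · refine adj_root (he _ _ hxy ?_)
    rintro rfl
    exact hne rfl
  · exact withIsolated_adj_some.2 (Or.inr ⟨rfl, hbd⟩)

/-- The hang group of the comb product contains all permutations of the copy at `u`. -/
lemma forall_copyHom_mem (hΔ : Δ.withIsolated.almostHangGroup (some j) = ⊤) {u : X}
    (hu : ∀ α ∈ Δ.withIsolated.edgePreserving,
      copyHom B u α ∈ (Γ.combAt Δ j).withIsolated.almostHangGroup (some (j, i)))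
    (α : Perm (Option B)) :
    copyHom B u α ∈ (Γ.combAt Δ j).withIsolated.almostHangGroup (some (j, i)) := by
  suffices h : Δ.withIsolated.almostHangGroup (some j) ≤
      ((Γ.combAt Δ j).withIsolated.almostHangGroup (some (j, i))).comap (copyHom B u) from
    h (hΔ ▸ Subgroup.mem_top α)
  refine (Subgroup.closure_le _).2 ?_
  rintro β (⟨hβ, hj⟩ | hβ)
  · refine Subgroup.subset_closure (Or.inl
      ⟨copyHom_mem_almostEdgePreserving_of_fix u hβ hj, ?_⟩)
    by_cases hi : i = u
    · subst hi
      rw [copyHom_apply_some_self, hj, copyEmbedding_some]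
    · exact copyHom_apply_some_of_ne hi β j
  · exact hu β hβ

lemma copyHom_swap [DecidableEq B] [DecidableEq X] (u : X) (b : B) :
    copyHom B u (swap (some b) none) = swap (some (b, u)) none := by
  refine Equiv.ext fun a => ?_
  rcases a with _ | ⟨c, y⟩
  · simpa using copyHom_apply u (swap (some b) none) none
  · by_cases hy : y = u
    · subst hy
      rw [copyHom_apply_some_self]
      by_cases hc : c = b
      · simp [hc]
      · rw [swap_apply_of_ne_of_ne (by simpa using hc) (by simp),
          swap_apply_of_ne_of_ne (by simpa using hc) (by simp), copyEmbedding_some]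
    · rw [copyHom_apply_some_of_ne hy, swap_apply_of_ne_of_ne (by simp [hy]) (by simp)]

/-- The transpositions with `none` each live in a single copy, and they generate all transpositions.
-/
lemma eq_top_of_forall_copyHom_mem [Finite X] [Finite B] {M : Subgroup (Perm (Option (B × X)))}
    (h : ∀ u (α : Perm (Option B)), copyHom B u α ∈ M) : M = ⊤ := by
  classical
  have hnone : ∀ a, swap a none ∈ M := by
    rintro (_ | ⟨b, x⟩)
    · rw [swap_self]
      exact M.one_mem
    · rw [← copyHom_swap]
      exact h x _
  rw [eq_top_iff, ← Perm.closure_isSwap, Subgroup.closure_le]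
  rintro _ ⟨a, c, hac, rfl⟩
  by_cases ha : a = none
  · subst ha
    rw [swap_comm]
    exact hnone c
  · rw [swap_comm, ← swap_mul_swap_mul_swap ha hac, swap_comm none c]
    exact M.mul_mem (M.mul_mem (hnone c) (hnone a)) (hnone c)

theorem almostHangGroup_combAt_eq_top [Finite X] [Finite B]
    (hΓ : Γ.withIsolated.almostHangGroup (some i) = ⊤)
    (hΔ : Δ.withIsolated.almostHangGroup (some j) = ⊤) :
    (Γ.combAt Δ j).withIsolated.almostHangGroup (some (j, i)) = ⊤ := by
  classical
  set M := (Γ.combAt Δ j).withIsolated.almostHangGroup (some (j, i)) with hM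
  refine eq_top_of_forall_copyHom_mem ?_
  by_contra! hbad
  have : Nonempty X := ⟨i⟩
  -- The bad vertices, viewed among the vertices of `Γ*`.
  set T : Set (Option X) := some '' {u | ∃ α : Perm (Option B), copyHom B u α ∉ M} with hT
  have hconj : ∀ q u, baseHom B q ∈ M → some u ∈ T → some (q u) ∈ T := by
    rintro q u hq ⟨_, ⟨α, hα⟩, hu⟩
    obtain rfl := Option.some_injective _ hu
    refine ⟨_, ⟨α, fun h => hα ?_⟩, rfl⟩
    rw [← baseHom_conj_copyHom] at h
    have := M.mul_mem (M.mul_mem (M.inv_mem hq) h) hq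
    simpa [mul_assoc] using this
  have hleaf : ∀ σ k, (σ ∈ Γ.withIsolated.almostEdgePreserving ∧ σ (some i) = some i) ∨
      σ ∈ Γ.withIsolated.edgePreserving → σ (some k) = none → some k ∉ T := by
    rintro σ k hσ hk ⟨_, ⟨α, hα⟩, hu⟩
    obtain rfl := Option.some_injective _ hu
    refine hα (forall_copyHom_mem hΔ (fun β hβ => Subgroup.subset_closure ?_) α)
    rcases hσ with ⟨hσ, hi⟩ | hσ
    · obtain ⟨m, hm⟩ := exists_forall_adj_eq_of_map_eq_none hσ hk
      refine Or.inl ⟨copyHom_mem_almostEdgePreserving hβ hm, copyHom_apply_some_of_ne ?_ β j⟩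
      -- `k` cannot be `i`: `σ` fixes `i` but sends `k` to `none`.
      rintro rfl
      simp [hi] at hk
    · exact Or.inr (copyHom_mem_edgePreserving hβ (not_adj_of_map_eq_none hσ hk))
  have hbase : ∀ σ, (σ ∈ Γ.withIsolated.almostEdgePreserving ∧ σ (some i) = some i) ∨
      σ ∈ Γ.withIsolated.edgePreserving → baseHom B (removeNone σ) ∈ M := by
    rintro σ (⟨hσ, hi⟩ | hσ)
    · refine Subgroup.subset_closure (Or.inl
        ⟨baseHom_mem_almostEdgePreserving (removeNone_mem_almostEdgePreserving hσ), ?_⟩)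
      have : removeNone σ i = i := Option.some_injective _ ((removeNone_some σ ⟨i, hi⟩).trans hi)
      rw [baseHom_apply_some, this]
    · exact Subgroup.subset_closure
        (Or.inr (baseHom_mem_edgePreserving (removeNone_mem_edgePreserving hσ)))
  have hinv : ∀ σ ∈ Γ.withIsolated.almostHangGroup (some i), Set.MapsTo σ T T := by
    intro σ hσ
    induction hσ using Subgroup.closure_induction with
    | mem σ hσ =>
      rintro _ ⟨k, hk, rfl⟩
      rcases hσk : σ (some k) with _ | y
      · exact absurd ⟨k, hk, rfl⟩ (hleaf σ k hσ hσk)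
      · have hy : removeNone σ k = y :=
          Option.some_injective _ ((removeNone_some σ ⟨y, hσk⟩).trans hσk)
        rw [← hy]
        exact hconj _ k (hbase σ hσ) ⟨k, hk, rfl⟩
    | one => exact Set.mapsTo_id T
    | mul σ τ _ _ h1 h2 => exact h1.comp h2
    -- Finiteness of `X` is what passes invariance to the inverse.
    | inv σ _ h => exact Perm.perm_symm_mapsTo_of_mapsTo σ h
  obtain ⟨u, α, hα⟩ := hbad
  have := hinv (swap (some u) none) (hΓ ▸ Subgroup.mem_top _) ⟨u, ⟨α, hα⟩, rfl⟩
  rw [swap_apply_left] at this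
  obtain ⟨_, _, h⟩ := this
  exact absurd h (by simp)

end Comb

end SimpleGraph

/-! ### From edge-replacements to almost edge-preserving permutations -/

namespace RootedLabeledGraph

variable {V W X B : Type*}

/-- The graph on the labels that corresponds to `G`. -/
def labelGraph (G : RootedLabeledGraph V X) : SimpleGraph X :=
  G.graph.comap G.label.symm

lemma labelGraph_adj (G : RootedLabeledGraph V X) {x y : X} :
    G.labelGraph.Adj x y ↔ G.graph.Adj (G.label.symm x) (G.label.symm y) := Iff.rfl

/-- `G_σ` is isomorphic to `G`. -/
def embeddingIso (G : RootedLabeledGraph V X) (σ : Perm X) : G.embedding σ ≃g G.graph where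
  toEquiv := (G.label.trans σ).trans G.label.symm
  map_rel_iff' := Iff.rfl

lemma ncard_edgeSet_embedding (G : RootedLabeledGraph V X) (σ : Perm X) :
    (G.embedding σ).edgeSet.ncard = G.graph.edgeSet.ncard :=
  Nat.card_congr (G.embeddingIso σ).mapEdgeSet

lemma embedding_adj (G : RootedLabeledGraph V X) (σ : Perm X) {u v : V} :
    (G.embedding σ).Adj u v ↔ G.labelGraph.Adj (σ (G.label u)) (σ (G.label v)) := Iff.rfl

lemma mem_autSet_iff [Finite V] (G : RootedLabeledGraph V X) {σ : Perm X} :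
    σ ∈ G.autSet ↔ σ ∈ G.labelGraph.edgePreserving := by
  constructor
  · intro h x y hxy
    rw [labelGraph_adj, ← show G.embedding σ = G.graph from h, embedding_adj] at hxy
    simpa using hxy
  · intro h
    have hle : G.graph.edgeSet ⊆ (G.embedding σ).edgeSet := by
      rw [SimpleGraph.edgeSet_subset_edgeSet]
      intro u v huv
      exact h _ _ (by simpa [labelGraph_adj] using huv)
    exact (SimpleGraph.edgeSet_inj.1 (Set.eq_of_subset_of_ncard_le hle
      (G.ncard_edgeSet_embedding σ).le)).symm

lemma edgeSet_replaceEdge (G : RootedLabeledGraph V X) {e e' : Sym2 X}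
    (h : ¬ (G.pairOf e').IsDiag) : (G.replaceEdge e e').edgeSet =
      G.graph.edgeSet \ {G.pairOf e} ∪ {G.pairOf e'} := by
  rw [replaceEdge, SimpleGraph.edgeSet_sup, SimpleGraph.edgeSet_deleteEdges,
    SimpleGraph.edgeSet_fromEdgeSet]
  congr 1
  ext f
  simp only [Set.mem_sdiff, Set.mem_singleton_iff]
  constructor
  · exact And.left
  · rintro rfl
    exact ⟨rfl, h⟩

lemma pairOf_label (G : RootedLabeledGraph V X) (f : Sym2 V) : G.pairOf (f.map G.label) = f := by
  simp [pairOf, Sym2.map_map]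

lemma mem_almostEdgePreserving_iff (G : RootedLabeledGraph V X) {σ : Perm X} :
    σ ∈ G.labelGraph.almostEdgePreserving ↔
      ∃ e : Sym2 X, G.graph.edgeSet \ {G.pairOf e} ⊆ (G.embedding σ).edgeSet := by
  refine exists_congr fun e => ⟨fun h => ?_, fun h x y hxy hne => ?_⟩
  · rintro ⟨u, v⟩ ⟨huv, hne⟩
    refine h (G.label u) (G.label v) (by simpa [labelGraph_adj] using huv) ?_
    rintro rfl
    exact hne (by simp [pairOf])
  · have := @h s(G.label.symm x, G.label.symm y) ⟨hxy, fun h => hne ?_⟩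
    · simpa [embedding_adj] using this
    · exact Sym2.map.injective G.label.symm.injective h

lemma mem_ferGenerators_iff [Finite V] (G : RootedLabeledGraph V X) {σ : Perm X} :
    σ ∈ G.ferGenerators ↔ σ ∈ G.labelGraph.almostEdgePreserving := by
  rw [mem_almostEdgePreserving_iff]
  constructor
  · rintro (h | ⟨e, e', h, hσ⟩)
    -- A diagonal pair as dummy exception: an automorphism loses no edge.
    · refine ⟨s(G.label G.root, G.label G.root), ?_⟩
      rw [show G.embedding σ = G.graph from h]
      exact Set.sdiff_subset
    · refine ⟨e, ?_⟩
      rw [show G.embedding σ = G.replaceEdge e e' from hσ,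
        edgeSet_replaceEdge G (SimpleGraph.not_isDiag_of_mem_edgeSet _ h.2.1)]
      exact Set.subset_union_left
  · rintro ⟨e, he⟩
    by_cases heq : G.embedding σ = G.graph
    · exact Or.inl heq
    have hcard := G.ncard_edgeSet_embedding σ
    have hnot : ¬ (G.embedding σ).edgeSet ⊆ G.graph.edgeSet := fun h =>
      heq (SimpleGraph.edgeSet_inj.1 (Set.eq_of_subset_of_ncard_le h hcard.ge))
    -- `f` is the edge gained; equal edge counts leave room for no other.
    obtain ⟨f, hf, hfG⟩ := Set.not_subset.1 hnot
    have hmem : G.pairOf e ∈ G.graph.edgeSet := by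
      by_contra hmem
      rw [Set.sdiff_singleton_eq_self hmem] at he
      exact heq (SimpleGraph.edgeSet_inj.1 (Set.eq_of_subset_of_ncard_le he hcard.le)).symm
    have hdiag : ¬ f.IsDiag := SimpleGraph.not_isDiag_of_mem_edgeSet _ hf
    have hσ : G.embedding σ = G.replaceEdge e (f.map G.label) := by
      refine SimpleGraph.edgeSet_inj.1 ?_
      rw [edgeSet_replaceEdge G (by rwa [pairOf_label]), pairOf_label]
      refine (Set.eq_of_subset_of_ncard_le (Set.union_subset he (by simpa using hf)) ?_).symm
      rw [Set.union_singleton, Set.ncard_insert_of_notMem (fun h => hfG h.1),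
        Set.ncard_sdiff_singleton_add_one hmem, hcard]
    refine Or.inr ⟨e, f.map G.label, ⟨hmem, ?_, ⟨hσ ▸ G.embeddingIso σ⟩⟩, hσ⟩
    rw [pairOf_label]
    induction f with
    | h u v => exact ⟨fun h => hdiag h, hfG⟩

lemma hangGroup_eq [Finite V] (G : RootedLabeledGraph V X) (i : X) :
    G.hangGroup i = G.labelGraph.almostHangGroup i := by
  have h1 : G.ferGeneratorsFixing i = {σ | σ ∈ G.labelGraph.almostEdgePreserving ∧ σ i = i} :=
    Set.ext fun σ => and_congr_left fun _ => G.mem_ferGenerators_iff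
  have h2 : G.autSet = G.labelGraph.edgePreserving := Set.ext fun σ => G.mem_autSet_iff
  rw [hangGroup, SimpleGraph.almostHangGroup, h1, h2]

lemma labelGraph_addIsolated (G : RootedLabeledGraph V X) :
    G.addIsolated.labelGraph = G.labelGraph.withIsolated := by
  ext (_ | x) (_ | y)
  · simp
  · exact iff_of_false SimpleGraph.withIsolated_not_adj_none
      SimpleGraph.withIsolated_not_adj_none
  · exact iff_of_false (fun h => SimpleGraph.withIsolated_not_adj_none h.symm)
      fun h => SimpleGraph.withIsolated_not_adj_none h.symm
  · exact (SimpleGraph.withIsolated_adj_some (Γ := G.graph)).trans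
      (SimpleGraph.withIsolated_adj_some (Γ := G.labelGraph)).symm

lemma labelGraph_comb (G : RootedLabeledGraph V X) (H : RootedLabeledGraph W B) :
    (G.comb H).labelGraph = G.labelGraph.combAt H.labelGraph (H.label H.root) := by
  ext ⟨b, x⟩ ⟨d, y⟩
  simp [labelGraph_adj, comb, SimpleGraph.combAt_adj, Equiv.symm_apply_eq]

end RootedLabeledGraph

theorem mainTheorem8 {V W X B : Type*} [Finite V] [Finite W] [Finite X] [Finite B]
    (G : RootedLabeledGraph V X) (H : RootedLabeledGraph W B) (i : X) (j : B)
    (hG : G.addIsolated.IsHangSymmetricWithRoot (some i))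
    (hH : H.addIsolated.IsHangSymmetricWithRoot (some j)) :
    (G.comb H).addIsolated.IsHangSymmetricWithRoot (some (j, i)) := by
  obtain ⟨hi, hG⟩ := hG
  obtain ⟨hj, hH⟩ := hH
  replace hi : G.label G.root = i := Option.some_injective _ hi
  replace hj : H.label H.root = j := Option.some_injective _ hj
  rw [RootedLabeledGraph.hangGroup_eq, RootedLabeledGraph.labelGraph_addIsolated] at hG hH
  refine ⟨congrArg some (Prod.ext hj hi), ?_⟩
  rw [RootedLabeledGraph.hangGroup_eq, RootedLabeledGraph.labelGraph_addIsolated,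
    RootedLabeledGraph.labelGraph_comb, hj]
  exact SimpleGraph.almostHangGroup_combAt_eq_top hG hH
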